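/- Let $\Omega$ be a non-empty set, let $\mathfrak F(\Omega)$ be the set of all functions $\Omega\to\mathbb R$, $B(\Omega)$ the set of bounded ones, and $B(\Omega)_+=\{f\in B(\Omega): f\ge 0 \text{ pointwise}\}$. Let $\ge_*$ be a reflexive and transitive relation on $\mathfrak F(\Omega)$ with asymmetric part $>_*$, such that: $1>_*0$; $f\ge g$ pointwise implies $f\ge_*g$; $f\ge_*g$ implies $bf+h\ge_*bg+h$ for all $b\in B(\Omega)_+$ and $h\in\mathfrak F(\Omega)$; and $f>_*0$ implies $f\wedge 1>_*0$. A finitely additive probability $P$ on the power set of $\Omega$ *represents* $\ge_*$ if for all $f,h\in\mathfrak F(\Omega)$: $f\ge_*h$ if and only if $\inf_{\varepsilon>0}P(f>h-\varepsilon)=1$. Let $\Pi(B(\Omega))$ be the set of arbitrage-free prices on $B(\Omega)$, i.e. of positively homogeneous, subadditive functionals $\rho:B(\Omega)\to\mathbb R$ with $\rho(1)=1$, such that $f\ge_*g$ implies $\rho(f)\ge\rho(g)$, and $f>_*0$ implies $\rho(f)>0$. For such $\rho$ put $$\mathfrak{ma}(\rho)=\sup\frac{\sum_{i\le N}\rho(f_i)-\rho\big(\sum_{i\le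 N}f_i\big)}{\sum_{i\le N}\rho(f_i)},\qquad \mathfrak{na}_c(\rho)=-\inf\,\lim_{k\to\infty}\frac{\sum_{n\le k}\rho(f_n)-\rho\big(\sum_{n}f_n\big)}{\sum_{n\le k}\rho(f_n)},$$ where the supremum is over all finite sequences $f_1,\dots,f_N$ in $B(\Omega)_+$ and the infimum is over all sequences $f_1,f_2,\dots$ in $B(\Omega)_+$ whose pointwise sum $\sum_nf_n$ belongs to $B(\Omega)$. Quotients, limits, the supremum and the infimum are taken in $[-\infty,+\infty]$, with $0/0=0$ and $a/0=-\infty$ for $a<0$. Then: (a) $\ge_*$ is represented by some finitely additive probability $P$ on the power set of $\Omega$ if and only if (i) for every $f\in\mathfrak F(\Omega)$, if $f+\varepsilon>_*0$ for all $\varepsilon>0$, then $f\ge_*0$; and (ii) there exists $\rho\in\Pi(B(\Omega))$ with $\mathfrak{ma}(\rho)<1$. (b) $\ge_*$ is represented by some countably additive probability $P$ on the power set of $\Omega$ if and only if (i) holds and there exists $\rho\in\Pi(B(\Omega))$ with $\mathfrak{ma}(\rho)<1$ and (iii) $\mathfrak{na}_c(\rho)<+\infty$. -/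

import Mathlib

open Filter Topology

noncomputable section

/-- `B(Ω)`: the bounded real functions on `Ω`. -/
def boundedFun (Ω : Type*) : Set (Ω → ℝ) := {f | ∃ C : ℝ, ∀ ω, |f ω| ≤ C}

/-- `B(Ω)₊`: the bounded functions that are pointwise nonnegative. -/
def boundedFunNonneg (Ω : Type*) : Set (Ω → ℝ) := {f | f ∈ boundedFun Ω ∧ 0 ≤ f}

/-- The asymmetric part `f >_* g` of a relation `f ≥_* g` (written `ge f g`). -/
def StrictPart {Ω : Type*} (ge : (Ω → ℝ) → (Ω → ℝ) → Prop) (f g : Ω → ℝ) : Prop :=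
  ge f g ∧ ¬ ge g f

/-- The axioms of the common order: a reflexive and transitive relation on the real functions on `Ω`
that is nontrivial, weaker than the pointwise order, stable under nonnegative bounded
multipliers and translations, and compatible with truncation. Here `1` and `0` are constant
functions, and `b * f`, `f ⊓ 1` are the pointwise product and minimum. -/
structure IsCommonOrder {Ω : Type*} (ge : (Ω → ℝ) → (Ω → ℝ) → Prop) : Prop where
  refl : ∀ f, ge f f
  trans : ∀ f g h, ge f g → ge g h → ge f h
  one_gt_zero : StrictPart ge 1 0
  of_pointwise : ∀ f g : Ω → ℝ, g ≤ f → ge f g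
  affine : ∀ f g b h : Ω → ℝ, b ∈ boundedFunNonneg Ω → ge f g → ge (b * f + h) (b * g + h)
  trunc : ∀ f, StrictPart ge f 0 → StrictPart ge (f ⊓ 1) 0

/-- The robustness axiom: if `f + ε >_* 0` for all `ε > 0`, then `f ≥_* 0`. -/
def IsRobustOrder {Ω : Type*} (ge : (Ω → ℝ) → (Ω → ℝ) → Prop) : Prop :=
  ∀ f : Ω → ℝ, (∀ ε : ℝ, 0 < ε → StrictPart ge (fun ω => f ω + ε) 0) → ge f 0

/-- Finitely additive probabilities on the power set of `Ω`. -/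
structure FinAddProb (Ω : Type*) where
  /-- the probability of a set -/
  prob : Set Ω → ℝ
  nonneg : ∀ A, 0 ≤ prob A
  univ : prob Set.univ = 1
  add : ∀ A B, Disjoint A B → prob (A ∪ B) = prob A + prob B

/-- Countable additivity (on the power set of `Ω`). -/
def FinAddProb.IsCountablyAdditive {Ω : Type*} (P : FinAddProb Ω) : Prop :=
  ∀ A : ℕ → Set Ω, Pairwise (fun i j => Disjoint (A i) (A j)) →
    HasSum (fun n => P.prob (A n)) (P.prob (⋃ n, A n))

/-- The ranking `f ≥_P h` induced by `P`: `inf_{ε > 0} P(f > h - ε) = 1`. -/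
def FinAddProb.ranking {Ω : Type*} (P : FinAddProb Ω) (f h : Ω → ℝ) : Prop :=
  ⨅ ε : Set.Ioi (0 : ℝ), P.prob {ω | f ω > h ω - ε} = 1

/-- `P` represents the order `ge`. -/
def FinAddProb.Represents {Ω : Type*} (P : FinAddProb Ω)
    (ge : (Ω → ℝ) → (Ω → ℝ) → Prop) : Prop :=
  ∀ f h : Ω → ℝ, ge f h ↔ P.ranking f h

/-- `π ∈ Π(X)`: an arbitrage-free price function on a set `X` of payoffs. Only the values
of `π` on `X` matter. -/
structure IsPriceFunction {Ω : Type*} (ge : (Ω → ℝ) → (Ω → ℝ) → Prop) (X : Set (Ω → ℝ))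
    (π : (Ω → ℝ) → ℝ) : Prop where
  pos_homog : ∀ f ∈ X, ∀ c : ℝ, 0 ≤ c → c • f ∈ X → π (c • f) = c * π f
  subadd : ∀ f ∈ X, ∀ g ∈ X, f + g ∈ X → π (f + g) ≤ π f + π g
  map_one : π 1 = 1
  mono : ∀ f ∈ X, ∀ g ∈ X, ge f g → π g ≤ π f
  no_arbitrage : ∀ f ∈ X, StrictPart ge f 0 → 0 < π f

/-- The quotient `a / d` of real numbers as an extended real number, for `d ≥ 0`, with the
convention `0 / 0 = 0` only: `a / 0` is `+∞` for `a > 0` and `-∞` for `a < 0`. -/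
def extQuot (a d : ℝ) : EReal :=
  if d = 0 then (if a = 0 then 0 else if a < 0 then ⊥ else ⊤) else ((a / d : ℝ) : EReal)

/-- Market power `ma(ρ; f₁, …, f_N)` on a finite sequence. -/
def marketPowerOn {Ω : Type*} (ρ : (Ω → ℝ) → ℝ) {N : ℕ} (f : Fin N → Ω → ℝ) : EReal :=
  extQuot (∑ i, ρ (f i) - ρ (∑ i, f i)) (∑ i, ρ (f i))

/-- Market power `ma(ρ)`: the supremum over all finite sequences in `B(Ω)₊`. -/
def marketPower {Ω : Type*} (ρ : (Ω → ℝ) → ℝ) : EReal :=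
  sSup {x | ∃ (N : ℕ) (f : Fin N → Ω → ℝ), (∀ i, f i ∈ boundedFunNonneg Ω) ∧
    x = marketPowerOn ρ f}

/-- The sequences in `B(Ω)₊` whose pointwise sum exists and is bounded. -/
def boundedSumSeq (Ω : Type*) : Set (ℕ → Ω → ℝ) :=
  {f | (∀ n, f n ∈ boundedFunNonneg Ω) ∧ (∀ ω, Summable fun n => f n ω) ∧
    (fun ω => ∑' n, f n ω) ∈ boundedFun Ω}

/-- The quotient whose limit in `k` is `ma_c(ρ; f₁, f₂, …)`. -/
def countableQuot {Ω : Type*} (ρ : (Ω → ℝ) → ℝ) (f : ℕ → Ω → ℝ) (k : ℕ) : EReal :=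
  extQuot (∑ n ∈ Finset.range k, ρ (f n) - ρ (fun ω => ∑' n, f n ω))
    (∑ n ∈ Finset.range k, ρ (f n))

/-- `ma_c(ρ; f₁, f₂, …)`, a limit in the extended reals; it exists for price functions, see
`tendsto_countablePowerOn`. -/
def countablePowerOn {Ω : Type*} (ρ : (Ω → ℝ) → ℝ) (f : ℕ → Ω → ℝ) : EReal :=
  limUnder atTop (countableQuot ρ f)

/-- `na_c(ρ)`: minus the infimum of `ma_c(ρ; f₁, f₂, …)` over all sequences in `B(Ω)₊` with
bounded sum. -/
def negCountablePower {Ω : Type*} (ρ : (Ω → ℝ) → ℝ) : EReal :=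
  - sInf {x | ∃ f ∈ boundedSumSeq Ω, x = countablePowerOn ρ f}

theorem extQuot_mono {r s t : ℝ} (hr : 0 ≤ r) (hs : 0 ≤ s) (hst : s ≤ t)
    (h : r = 0 → t = 0) : extQuot (s - r) s ≤ extQuot (t - r) t := by
  rcases hr.eq_or_lt with rfl | hr
  · obtain rfl := h rfl
    obtain rfl := le_antisymm hst hs
    exact le_rfl
  rcases hs.eq_or_lt with rfl | hs
  · have h1 : extQuot (0 - r) 0 = ⊥ := by
      have h2 : (0 : ℝ) - r < 0 := by linarith
      rw [extQuot, if_pos rfl, if_neg h2.ne, if_pos h2]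
    rw [h1]
    exact bot_le
  · have ht : 0 < t := hs.trans_le hst
    rw [extQuot, extQuot, if_neg hs.ne', if_neg ht.ne', EReal.coe_le_coe_iff, sub_div, sub_div,
      div_self hs.ne', div_self ht.ne']
    gcongr

/-- The limit that defines `ma_c(ρ; f₁, f₂, …)` exists for every price function on `B(Ω)`. -/
theorem tendsto_countablePowerOn {Ω : Type*} {ge : (Ω → ℝ) → (Ω → ℝ) → Prop}
    (hge : IsCommonOrder ge) {ρ : (Ω → ℝ) → ℝ} (hρ : IsPriceFunction ge (boundedFun Ω) ρ)
    {f : ℕ → Ω → ℝ} (hf : f ∈ boundedSumSeq Ω) :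
    Tendsto (countableQuot ρ f) atTop (𝓝 (countablePowerOn ρ f)) := by
  obtain ⟨hf1, hf2, hf3⟩ := hf
  have hz : (0 : Ω → ℝ) ∈ boundedFun Ω := ⟨0, fun ω => by simp⟩
  have hρ0 : ρ 0 = 0 := by
    have := hρ.pos_homog 0 hz 0 le_rfl (by simpa using hz)
    simpa using this
  have hpos : ∀ g ∈ boundedFun Ω, 0 ≤ g → 0 ≤ ρ g := fun g hg h => by
    have := hρ.mono g hg 0 hz (hge.of_pointwise g 0 h)
    rwa [hρ0] at this
  have hfn : ∀ n, 0 ≤ ρ (f n) := fun n => hpos _ (hf1 n).1 (hf1 n).2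
  have hle : ∀ n, ρ (f n) ≤ ρ (fun ω => ∑' n, f n ω) := fun n =>
    hρ.mono _ hf3 _ (hf1 n).1 (hge.of_pointwise _ _ fun ω =>
      (hf2 ω).le_tsum n fun j _ => (hf1 j).2 ω)
  have hmono : Monotone (countableQuot ρ f) := by
    intro k l hkl
    refine extQuot_mono ((hfn 0).trans (hle 0)) (Finset.sum_nonneg fun n _ => hfn n)
      (Finset.sum_le_sum_of_subset_of_nonneg (Finset.range_mono hkl) fun n _ _ => hfn n) ?_
    intro h0
    exact Finset.sum_eq_zero fun n _ => le_antisymm (h0 ▸ hle n) (hfn n)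
  have := tendsto_atTop_iSup hmono
  rw [countablePowerOn, this.limUnder_eq]
  exact this

end

/-! A robust common order is determined by its null sets, the `A` with `ge 0 (A.indicator 1)`. If `f
≥_* h`, multiplying `f - h` by an indicator shows that each event `f ≤ h - ε` is null. Conversely,
truncation makes even unbounded functions on null sets negligible, so null shortfalls give `f - h +
ε >_* 0` for every `ε > 0`, and robustness removes `ε`. Hence `P` represents the order iff the order
is robust and `P` has the same null sets (`represents_iff`).

If `P` represents the order, its expectation is an arbitrage-free price. Additivity makes its market
power at most zero, and for countably additive `P` bounded monotone convergence bounds the countable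
quotients from below.

Conversely, `ma(ρ) < 1` means `∑ ρ(f i) ≤ K ρ(∑ f i)` for some constant `K`. Then the supremum of `∑
ρ(1_{A_i})` over finite partitions of `A` is additive in `A` and lies between `ρ(1_A)` and `K
ρ(1_A)` (`exists_additive_majorant`). Normalized, it is a probability with the null sets of `ρ`,
which by monotonicity and no arbitrage are those of the order. If `na_c(ρ) < ∞`, this probability is
countably subadditive up to a constant; applied to tails of a disjoint sequence, that forces
countable additivity. -/

namespace FinAddProb

variable {Ω : Type*} (P : FinAddProb Ω)

/-! ### Elementary properties of finitely additive probabilities -/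

theorem prob_empty : P.prob ∅ = 0 := by
  simpa using P.add ∅ ∅ (by simp)

theorem prob_mono {A B : Set Ω} (h : A ⊆ B) : P.prob A ≤ P.prob B := by
  have h1 := P.add A (B \ A) Set.disjoint_sdiff_right
  rw [Set.union_sdiff_cancel h] at h1
  linarith [P.nonneg (B \ A)]

theorem prob_add_compl (A : Set Ω) : P.prob A + P.prob Aᶜ = 1 := by
  rw [← P.add A Aᶜ disjoint_compl_right, Set.union_compl_self, P.univ]

theorem prob_le_one (A : Set Ω) : P.prob A ≤ 1 :=
  (P.prob_mono (Set.subset_univ A)).trans P.univ.le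

theorem ranking_iff (f h : Ω → ℝ) :
    P.ranking f h ↔ ∀ ε : ℝ, 0 < ε → P.prob {ω | f ω ≤ h ω - ε} = 0 := by
  have hc : ∀ ε : ℝ, {ω | f ω ≤ h ω - ε} = {ω | f ω > h ω - ε}ᶜ := fun ε => by
    ext ω
    simp
  have hbdd : BddBelow (Set.range fun ε : Set.Ioi (0 : ℝ) => P.prob {ω | f ω > h ω - ε}) :=
    ⟨0, by rintro _ ⟨ε, rfl⟩; exact P.nonneg _⟩
  have : Nonempty (Set.Ioi (0 : ℝ)) := ⟨⟨1, Set.mem_Ioi.2 one_pos⟩⟩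
  constructor
  · intro hr ε hε
    have h1 : 1 ≤ P.prob {ω | f ω > h ω - ε} := hr.symm.le.trans (ciInf_le hbdd ⟨ε, hε⟩)
    rw [hc]
    linarith [P.prob_add_compl {ω | f ω > h ω - ε}, P.nonneg {ω | f ω > h ω - ε}ᶜ]
  · intro hr
    refine le_antisymm ((ciInf_le hbdd ⟨1, Set.mem_Ioi.2 one_pos⟩).trans (P.prob_le_one _)) (le_ciInf ?_)
    rintro ⟨ε, hε⟩
    have h1 := hr ε hε
    rw [hc] at h1
    linarith [P.prob_add_compl {ω | f ω > h ω - ε}]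

/-! ### Integration against a finitely additive probability -/

/-- The integral of a simple function. -/
noncomputable def simpleExpect (s : @MeasureTheory.SimpleFunc Ω ⊤ ℝ) : ℝ :=
  @MeasureTheory.SimpleFunc.setToSimpleFunc Ω ℝ ℝ _ _ _ _ ⊤
    (fun A => P.prob A • ContinuousLinearMap.id ℝ ℝ) s

/-- With the σ-algebra `⊤` and the zero measure, the measurability, finiteness and integrability
side conditions of the simple-function calculus hold automatically, so it applies to a merely
finitely additive `P`. -/
theorem finMeasAdditive_prob :
    @MeasureTheory.FinMeasAdditive Ω _ _ ⊤ 0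
      (fun A => P.prob A • ContinuousLinearMap.id ℝ ℝ) := by
  intro A B _ _ _ _ hAB
  simp only [P.add A B hAB, add_smul]

theorem simpleExpect_add (s t : @MeasureTheory.SimpleFunc Ω ⊤ ℝ) :
    P.simpleExpect (s + t) = P.simpleExpect s + P.simpleExpect t :=
  MeasureTheory.SimpleFunc.setToSimpleFunc_add _ P.finMeasAdditive_prob
    (MeasureTheory.integrable_zero_measure) (MeasureTheory.integrable_zero_measure)

theorem simpleExpect_smul (c : ℝ) (s : @MeasureTheory.SimpleFunc Ω ⊤ ℝ) :
    P.simpleExpect (c • s) = c * P.simpleExpect s :=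
  MeasureTheory.SimpleFunc.setToSimpleFunc_smul_real _ P.finMeasAdditive_prob c
    (MeasureTheory.integrable_zero_measure)

theorem simpleExpect_mono {s t : @MeasureTheory.SimpleFunc Ω ⊤ ℝ} (h : ∀ ω, s ω ≤ t ω) :
    P.simpleExpect s ≤ P.simpleExpect t :=
  MeasureTheory.SimpleFunc.setToSimpleFunc_mono P.finMeasAdditive_prob
    (fun A _ _ x hx => by simpa using mul_nonneg (P.nonneg A) hx)
    (MeasureTheory.integrable_zero_measure) (MeasureTheory.integrable_zero_measure) h

theorem simpleExpect_const (c : ℝ) :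
    P.simpleExpect (@MeasureTheory.SimpleFunc.const Ω ℝ ⊤ c) = c := by
  rw [simpleExpect, MeasureTheory.SimpleFunc.setToSimpleFunc_const]
  · simp [P.univ]
  · simp [P.prob_empty]

theorem exists_simpleFunc_indicator (A : Set Ω) :
    ∃ s : @MeasureTheory.SimpleFunc Ω ⊤ ℝ, ⇑s = A.indicator 1 ∧ P.simpleExpect s = P.prob A := by
  classical
  let _ : MeasurableSpace Ω := ⊤
  have hA : MeasurableSet A := trivial
  refine ⟨MeasureTheory.SimpleFunc.piecewise A hA (MeasureTheory.SimpleFunc.const Ω 1)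
    (MeasureTheory.SimpleFunc.const Ω 0), ?_, ?_⟩
  · rw [MeasureTheory.SimpleFunc.coe_piecewise]
    ext ω
    by_cases h : ω ∈ A <;> simp [h]
  · rw [simpleExpect, MeasureTheory.SimpleFunc.setToSimpleFunc_indicator]
    · simp
    · simp [P.prob_empty]

theorem exists_simpleFunc_approx {f : Ω → ℝ} (hf : f ∈ boundedFun Ω) {ε : ℝ} (hε : 0 < ε) :
    ∃ s : @MeasureTheory.SimpleFunc Ω ⊤ ℝ, ∀ ω, s ω ≤ f ω ∧ f ω ≤ s ω + ε := by
  obtain ⟨C, hC⟩ := hf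
  let _ : MeasurableSpace Ω := ⊤
  -- Round `f` down to a multiple of `ε`; boundedness leaves finitely many values.
  refine ⟨⟨fun ω => ε * ⌊f ω / ε⌋, fun _ => trivial, ?_⟩, fun ω => ?_⟩
  · refine ((Set.finite_Icc ⌊-C / ε⌋ ⌊C / ε⌋).image fun n : ℤ => ε * (n : ℝ)).subset ?_
    rintro _ ⟨ω, rfl⟩
    have := abs_le.1 (hC ω)
    exact ⟨⌊f ω / ε⌋, ⟨by gcongr; exact this.1, by gcongr; exact this.2⟩, rfl⟩
  · have h1 : ε * (f ω / ε) = f ω := by field_simp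
    have h2 := mul_le_mul_of_nonneg_left (Int.floor_le (f ω / ε)) hε.le
    have h3 := mul_le_mul_of_nonneg_left (Int.lt_floor_add_one (f ω / ε)).le hε.le
    change ε * (⌊f ω / ε⌋ : ℝ) ≤ f ω ∧ f ω ≤ ε * (⌊f ω / ε⌋ : ℝ) + ε
    constructor <;> linarith

/-- The integral of a bounded function, as the infimum over simple majorants. -/
noncomputable def expect (f : Ω → ℝ) : ℝ :=
  sInf {x | ∃ s : @MeasureTheory.SimpleFunc Ω ⊤ ℝ, (∀ ω, f ω ≤ s ω) ∧ x = P.simpleExpect s}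

theorem expect_le_simpleExpect {f : Ω → ℝ} (hf : f ∈ boundedFun Ω)
    {s : @MeasureTheory.SimpleFunc Ω ⊤ ℝ} (h : ∀ ω, f ω ≤ s ω) :
    P.expect f ≤ P.simpleExpect s := by
  obtain ⟨C, hC⟩ := hf
  refine csInf_le ⟨-C, ?_⟩ ⟨s, h, rfl⟩
  rintro _ ⟨t, ht, rfl⟩
  rw [← P.simpleExpect_const (-C)]
  exact P.simpleExpect_mono fun ω => (abs_le.1 (hC ω)).1.trans (ht ω)

theorem simpleExpect_le_expect {f : Ω → ℝ} (hf : f ∈ boundedFun Ω)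
    {s : @MeasureTheory.SimpleFunc Ω ⊤ ℝ} (h : ∀ ω, s ω ≤ f ω) :
    P.simpleExpect s ≤ P.expect f := by
  obtain ⟨C, hC⟩ := hf
  refine le_csInf ⟨_, @MeasureTheory.SimpleFunc.const Ω ℝ ⊤ C, fun ω => (abs_le.1 (hC ω)).2, rfl⟩ ?_
  rintro _ ⟨t, ht, rfl⟩
  exact P.simpleExpect_mono fun ω => (h ω).trans (ht ω)

theorem exists_simpleExpect_approx {f : Ω → ℝ} (hf : f ∈ boundedFun Ω) {ε : ℝ} (hε : 0 < ε) :
    ∃ s : @MeasureTheory.SimpleFunc Ω ⊤ ℝ, (∀ ω, s ω ≤ f ω ∧ f ω ≤ s ω + ε) ∧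
      P.expect f ≤ P.simpleExpect s + ε := by
  obtain ⟨s, hs⟩ := exists_simpleFunc_approx hf hε
  refine ⟨s, hs, ?_⟩
  have h1 := P.expect_le_simpleExpect hf
    (s := s + @MeasureTheory.SimpleFunc.const Ω ℝ ⊤ ε) fun ω => (hs ω).2
  rwa [simpleExpect_add, simpleExpect_const] at h1

theorem expect_mono {f g : Ω → ℝ} (hf : f ∈ boundedFun Ω) (hg : g ∈ boundedFun Ω)
    (h : ∀ ω, f ω ≤ g ω) : P.expect f ≤ P.expect g := by
  refine le_of_forall_pos_le_add fun ε hε => ?_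
  obtain ⟨s, hs, hs'⟩ := P.exists_simpleExpect_approx hf hε
  have := P.simpleExpect_le_expect hg (s := s) fun ω => (hs ω).1.trans (h ω)
  linarith

theorem expect_const (c : ℝ) : P.expect (fun _ => c) = c := by
  have hc : (fun _ => c : Ω → ℝ) ∈ boundedFun Ω := ⟨|c|, fun _ => le_rfl⟩
  refine le_antisymm ?_ ?_
  · simpa only [simpleExpect_const] using P.expect_le_simpleExpect hc
      (s := @MeasureTheory.SimpleFunc.const Ω ℝ ⊤ c) fun _ => le_rfl
  · simpa only [simpleExpect_const] using P.simpleExpect_le_expect hc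
      (s := @MeasureTheory.SimpleFunc.const Ω ℝ ⊤ c) fun _ => le_rfl

theorem indicator_mem_boundedFun (A : Set Ω) : A.indicator (1 : Ω → ℝ) ∈ boundedFun Ω :=
  ⟨1, fun ω => by by_cases h : ω ∈ A <;> simp [h]⟩

theorem expect_indicator (A : Set Ω) : P.expect (A.indicator 1) = P.prob A := by
  obtain ⟨s, hs, hsA⟩ := P.exists_simpleFunc_indicator A
  rw [← hsA]
  exact le_antisymm
    (P.expect_le_simpleExpect (indicator_mem_boundedFun A) fun ω => (congrFun hs ω).ge)
    (P.simpleExpect_le_expect (indicator_mem_boundedFun A) fun ω => (congrFun hs ω).le)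

theorem add_mem_boundedFun {f g : Ω → ℝ} (hf : f ∈ boundedFun Ω) (hg : g ∈ boundedFun Ω) :
    f + g ∈ boundedFun Ω := by
  obtain ⟨C, hC⟩ := hf
  obtain ⟨D, hD⟩ := hg
  exact ⟨C + D, fun ω => (abs_add_le _ _).trans (add_le_add (hC ω) (hD ω))⟩

theorem smul_mem_boundedFun {f : Ω → ℝ} (hf : f ∈ boundedFun Ω) (c : ℝ) :
    c • f ∈ boundedFun Ω := by
  obtain ⟨C, hC⟩ := hf
  refine ⟨|c| * C, fun ω => ?_⟩
  simp only [Pi.smul_apply, smul_eq_mul, abs_mul]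
  exact mul_le_mul_of_nonneg_left (hC ω) (abs_nonneg c)

theorem expect_add {f g : Ω → ℝ} (hf : f ∈ boundedFun Ω) (hg : g ∈ boundedFun Ω) :
    P.expect (f + g) = P.expect f + P.expect g := by
  have hfg := add_mem_boundedFun hf hg
  refine le_antisymm (le_of_forall_pos_le_add fun ε hε => ?_)
    (le_of_forall_pos_le_add fun ε hε => ?_)
  all_goals
    obtain ⟨s, hs, hs'⟩ := P.exists_simpleExpect_approx hf (half_pos hε)
    obtain ⟨t, ht, ht'⟩ := P.exists_simpleExpect_approx hg (half_pos hε)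
  · have h1 := P.expect_le_simpleExpect hfg
      (s := s + t + @MeasureTheory.SimpleFunc.const Ω ℝ ⊤ ε) fun ω => by
        have := (hs ω).2
        have := (ht ω).2
        change f ω + g ω ≤ s ω + t ω + ε
        linarith
    rw [simpleExpect_add, simpleExpect_add, simpleExpect_const] at h1
    linarith [P.simpleExpect_le_expect hf fun ω => (hs ω).1,
      P.simpleExpect_le_expect hg fun ω => (ht ω).1]
  · have h1 := P.simpleExpect_le_expect hfg (s := s + t) fun ω =>
      add_le_add (hs ω).1 (ht ω).1
    rw [simpleExpect_add] at h1
    linarith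

theorem expect_smul {f : Ω → ℝ} (hf : f ∈ boundedFun Ω) {c : ℝ} (hc : 0 ≤ c) :
    P.expect (c • f) = c * P.expect f := by
  have hcf := smul_mem_boundedFun hf c
  rcases hc.eq_or_lt with rfl | hc
  · rw [zero_smul, zero_mul]
    exact P.expect_const 0
  refine le_antisymm (le_of_forall_pos_le_add fun ε hε => ?_)
    (le_of_forall_pos_le_add fun ε hε => ?_)
  all_goals
    obtain ⟨s, hs, hs'⟩ := P.exists_simpleExpect_approx hf (div_pos hε hc)
    have hcε : c * (ε / c) = ε := by field_simp
  · have h1 := P.expect_le_simpleExpect hcf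
      (s := c • s + @MeasureTheory.SimpleFunc.const Ω ℝ ⊤ ε) fun ω => by
        have := mul_le_mul_of_nonneg_left (hs ω).2 hc.le
        change c * f ω ≤ c * s ω + ε
        linarith
    rw [simpleExpect_add, simpleExpect_smul, simpleExpect_const] at h1
    have := mul_le_mul_of_nonneg_left (P.simpleExpect_le_expect hf fun ω => (hs ω).1) hc.le
    linarith
  · have h1 := P.simpleExpect_le_expect hcf (s := c • s) fun ω =>
      mul_le_mul_of_nonneg_left (hs ω).1 hc.le
    rw [simpleExpect_smul] at h1
    have := mul_le_mul_of_nonneg_left hs' hc.le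
    linarith

theorem sum_mem_boundedFun {ι : Type*} (t : Finset ι) {f : ι → Ω → ℝ}
    (hf : ∀ i ∈ t, f i ∈ boundedFun Ω) : ∑ i ∈ t, f i ∈ boundedFun Ω := by
  classical
  induction t using Finset.induction_on with
  | empty => exact ⟨0, fun ω => by simp⟩
  | insert a t ha ih =>
    rw [Finset.sum_insert ha]
    exact add_mem_boundedFun (hf a (Finset.mem_insert_self a t))
      (ih fun i hi => hf i (Finset.mem_insert_of_mem hi))

theorem expect_sum {ι : Type*} (t : Finset ι) {f : ι → Ω → ℝ}
    (hf : ∀ i ∈ t, f i ∈ boundedFun Ω) : P.expect (∑ i ∈ t, f i) = ∑ i ∈ t, P.expect (f i) := by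
  classical
  induction t using Finset.induction_on with
  | empty => exact P.expect_const 0
  | insert a t ha ih =>
    rw [Finset.sum_insert ha, Finset.sum_insert ha,
      P.expect_add (hf a (Finset.mem_insert_self a t))
        (sum_mem_boundedFun t fun i hi => hf i (Finset.mem_insert_of_mem hi)),
      ih fun i hi => hf i (Finset.mem_insert_of_mem hi)]

/-- Comparison of integrals up to an exceptional set. -/
theorem expect_le_of_le_add {f g : Ω → ℝ} (hf : f ∈ boundedFun Ω) (hg : g ∈ boundedFun Ω)
    {ε C : ℝ} (hC : 0 ≤ C) {A : Set Ω} (h : ∀ ω, f ω ≤ g ω + ε + C * A.indicator 1 ω) :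
    P.expect f ≤ P.expect g + ε + C * P.prob A := by
  have hε : (fun _ => ε : Ω → ℝ) ∈ boundedFun Ω := ⟨|ε|, fun _ => le_rfl⟩
  have hA := smul_mem_boundedFun (indicator_mem_boundedFun A) C
  have h1 := P.expect_mono hf (add_mem_boundedFun (add_mem_boundedFun hg hε) hA) h
  rwa [P.expect_add (add_mem_boundedFun hg hε) hA, P.expect_add hg hε, P.expect_const,
    P.expect_smul (indicator_mem_boundedFun A) hC, P.expect_indicator] at h1

end FinAddProb

/-! ### Common orders and their null sets -/

namespace IsCommonOrder

variable {Ω : Type*} {ge : (Ω → ℝ) → (Ω → ℝ) → Prop}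

theorem ge_mul (hge : IsCommonOrder ge) {f g b : Ω → ℝ} (hb : b ∈ boundedFunNonneg Ω)
    (h : ge f g) : ge (b * f) (b * g) := by
  simpa using hge.affine f g b 0 hb h

theorem ge_add (hge : IsCommonOrder ge) {f g : Ω → ℝ} (h : Ω → ℝ) (hfg : ge f g) :
    ge (f + h) (g + h) := by
  simpa using hge.affine f g 1 h ⟨⟨1, fun _ => by simp⟩, fun _ => zero_le_one⟩ hfg

theorem indicator_mem (A : Set Ω) : A.indicator (1 : Ω → ℝ) ∈ boundedFunNonneg Ω :=
  ⟨FinAddProb.indicator_mem_boundedFun A, Set.indicator_nonneg fun _ _ => zero_le_one⟩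

theorem const_mem {c : ℝ} (hc : 0 ≤ c) : (fun _ => c : Ω → ℝ) ∈ boundedFunNonneg Ω :=
  ⟨⟨|c|, fun _ => le_rfl⟩, fun _ => hc⟩

/-- If `f ≥_* h`, then the event that `f` falls short of `h` by `ε` is negligible. -/
theorem null_of_ge (hge : IsCommonOrder ge) {f h : Ω → ℝ} (hfh : ge f h) {ε : ℝ} (hε : 0 < ε) :
    ge 0 ({ω | f ω ≤ h ω - ε}.indicator 1) := by
  classical
  set A := {ω | f ω ≤ h ω - ε} with hA
  have h1 : ge (f - h) 0 := by
    have := hge.ge_add (-h) hfh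
    rwa [add_neg_cancel, ← sub_eq_add_neg] at this
  have h2 : ge (A.indicator 1 * (f - h)) 0 := by
    simpa using hge.ge_mul (indicator_mem A) h1
  have h3 : ge ((fun _ => ε⁻¹) * (A.indicator 1 * (f - h))) 0 := by
    simpa using hge.ge_mul (const_mem (inv_pos.2 hε).le) h2
  -- On `A` the shortfall is at least `ε`, so `ε⁻¹ (f - h) ≤ -1` there.
  have h4 : ge (-A.indicator 1) 0 := by
    refine hge.trans _ _ _ (hge.of_pointwise _ _ fun ω => ?_) h3
    by_cases hω : ω ∈ A
    · have h5 : f ω - h ω ≤ -ε := by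
        have : f ω ≤ h ω - ε := hω
        linarith
      have h6 := mul_le_mul_of_nonneg_left h5 (inv_pos.2 hε).le
      rw [mul_neg, inv_mul_cancel₀ hε.ne'] at h6
      simpa [hω] using h6
    · simp [hω]
  simpa using hge.ge_add (A.indicator 1) h4

/-- A function supported by a negligible set is negligible, even if it is unbounded. -/
theorem null_of_support (hge : IsCommonOrder ge) {A : Set Ω} (hA : ge 0 (A.indicator 1))
    {k : Ω → ℝ} (hk : 0 ≤ k) (hkA : ∀ ω, ω ∉ A → k ω = 0) : ge 0 k := by
  classical
  by_contra hn
  refine (hge.trunc k ⟨hge.of_pointwise _ _ hk, hn⟩).2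
    (hge.trans _ _ _ hA (hge.of_pointwise _ _ fun ω => ?_))
  by_cases hω : ω ∈ A
  · simp [hω]
  · simp [hω, hkA ω hω]

theorem const_gt_zero (hge : IsCommonOrder ge) {c : ℝ} (hc : 0 < c) : ¬ ge 0 (fun _ => c) := by
  intro h
  refine hge.one_gt_zero.2 ?_
  have h1 := hge.ge_mul (const_mem (inv_pos.2 hc).le) h
  have h2 : (fun _ => c⁻¹) * (fun _ => c) = (1 : Ω → ℝ) := by
    ext
    simp [hc.ne']
  rwa [mul_zero, h2] at h1

/-- Up to a function supported on a null set, `f - h + ε` is at least `ε / 2`, hence strictly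
positive in the order; robustness then lets `ε` vanish. -/
theorem ge_of_null (hge : IsCommonOrder ge) (hr : IsRobustOrder ge) {f h : Ω → ℝ}
    (hfh : ∀ ε : ℝ, 0 < ε → ge 0 ({ω | f ω ≤ h ω - ε}.indicator 1)) : ge f h := by
  have h0 : ge (f - h) 0 := by
    refine hr _ fun ε hε => ?_
    -- The correction `k` may be unbounded; this is where the truncation axiom enters.
    set k : Ω → ℝ := {ω | f ω ≤ h ω - ε / 2}.indicator fun ω => |f ω - h ω| with hk
    have hk0 : ge 0 k := hge.null_of_support (hfh _ (half_pos hε))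
      (Set.indicator_nonneg fun _ _ => abs_nonneg _) fun ω hω => Set.indicator_of_notMem hω _
    have h1 : ge (fun ω => (f - h) ω + ε) ((fun _ => ε / 2) - k) := by
      refine hge.of_pointwise _ _ fun ω => ?_
      have h2 := neg_abs_le (f ω - h ω)
      by_cases hω : ω ∈ {ω | f ω ≤ h ω - ε / 2}
      · have h3 : k ω = |f ω - h ω| := Set.indicator_of_mem hω _
        simp only [Pi.sub_apply, h3]
        linarith
      · have h3 : k ω = 0 := Set.indicator_of_notMem hω _
        have h4 : h ω - ε / 2 < f ω := not_le.1 hω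
        simp only [Pi.sub_apply, h3]
        linarith
    have h2 : ge ((fun _ => ε / 2) - k) (fun _ => ε / 2) := by
      have := hge.ge_add ((fun _ => ε / 2) - k) hk0
      simpa using this
    have h3 := hge.trans _ _ _ h1 h2
    exact ⟨hge.trans _ _ _ h3 (hge.of_pointwise _ _ fun _ => (half_pos hε).le),
      fun h4 => hge.const_gt_zero (half_pos hε) (hge.trans _ _ _ h4 h3)⟩
  simpa using hge.ge_add h h0

end IsCommonOrder

/-! ### Representation by null sets, and expectation as a price -/

namespace FinAddProb

variable {Ω : Type*} {ge : (Ω → ℝ) → (Ω → ℝ) → Prop}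

/-- A probability represents a common order exactly if the order is robust and both have the
same null sets. -/
theorem represents_iff (hge : IsCommonOrder ge) (P : FinAddProb Ω) :
    P.Represents ge ↔
      IsRobustOrder ge ∧ ∀ A : Set Ω, P.prob A = 0 ↔ ge 0 (A.indicator 1) := by
  classical
  constructor
  · intro hP
    refine ⟨fun f hf => ?_, fun A => ?_⟩
    · rw [hP, ranking_iff]
      intro ε hε
      have h1 := (P.ranking_iff _ _).1 ((hP _ _).1 (hf (ε / 2) (half_pos hε)).1) _ (half_pos hε)
      refine le_antisymm (h1 ▸ P.prob_mono fun ω hω => ?_) (P.nonneg _)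
      simp only [Set.mem_ofPred_eq, Pi.zero_apply] at hω ⊢
      linarith
    · rw [hP, ranking_iff]
      constructor
      · intro hA ε hε
        refine le_antisymm (hA ▸ P.prob_mono fun ω hω => ?_) (P.nonneg _)
        by_contra hωA
        simp only [Set.mem_ofPred_eq, Pi.zero_apply, Set.indicator_of_notMem hωA] at hω
        linarith
      · intro hA
        refine le_antisymm (hA 1 one_pos ▸ P.prob_mono fun ω hω => ?_) (P.nonneg _)
        simp [hω]
  · rintro ⟨hr, hnull⟩ f h
    rw [ranking_iff]
    exact ⟨fun hfh ε hε => (hnull _).2 (hge.null_of_ge hfh hε),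
      fun hfh => hge.ge_of_null hr fun ε hε => (hnull _).1 (hfh ε hε)⟩

theorem Represents.isPriceFunction_expect {P : FinAddProb Ω} (hP : P.Represents ge) :
    IsPriceFunction ge (boundedFun Ω) P.expect where
  pos_homog f hf c hc _ := P.expect_smul hf hc
  subadd f hf g hg _ := (P.expect_add hf hg).le
  map_one := P.expect_const 1
  mono f hf g hg hfg := by
    classical
    obtain ⟨C, hC⟩ := hf
    obtain ⟨D, hD⟩ := hg
    refine le_of_forall_pos_le_add fun ε hε => ?_
    have h0 := (P.ranking_iff _ _).1 ((hP _ _).1 hfg) ε hε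
    -- Off the null event `f ≤ g - ε` the loss is at most `ε`; on it, `|C| + |D|` bounds `g - f`.
    have h1 := P.expect_le_of_le_add ⟨D, hD⟩ ⟨C, hC⟩ (add_nonneg (abs_nonneg C) (abs_nonneg D))
      (ε := ε) (A := {ω | f ω ≤ g ω - ε}) fun ω => ?_
    · rwa [h0, mul_zero, add_zero] at h1
    · by_cases hω : ω ∈ {ω | f ω ≤ g ω - ε}
      · rw [Set.indicator_of_mem hω, Pi.one_apply, mul_one]
        linarith [(abs_le.1 (hC ω)).1, (abs_le.1 (hD ω)).2, le_abs_self C, le_abs_self D]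
      · rw [Set.indicator_of_notMem hω, mul_zero]
        have h2 : g ω - ε < f ω := not_le.1 fun h3 => hω h3
        linarith
  no_arbitrage f hf hpos := by
    classical
    obtain ⟨hf0, hfn⟩ := hpos
    rw [hP, ranking_iff] at hf0 hfn
    push Not at hfn
    obtain ⟨ε, hε, hAε⟩ := hfn
    simp only [Pi.zero_apply, zero_sub] at hf0 hAε
    have hA' : 0 < P.prob {ω | ε ≤ f ω} := by
      refine lt_of_le_of_ne (P.nonneg _) (Ne.symm ?_)
      convert hAε using 3
      ext ω
      simp
    obtain ⟨C, hC⟩ := hf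
    -- The price of `f` is at least `δ / 2`: `ε` times the indicator of `f ≥ ε` has expectation `δ`,
    -- and it exceeds `f` by at most `δ / 2` off the null event `f ≤ -(δ / 2)`.
    set δ := ε * P.prob {ω | ε ≤ f ω} with hδ
    have hδ0 : 0 < δ := mul_pos hε hA'
    have h1 := P.expect_le_of_le_add
      (smul_mem_boundedFun (indicator_mem_boundedFun {ω | ε ≤ f ω}) ε) ⟨C, hC⟩ (abs_nonneg C)
      (ε := δ / 2) (A := {ω | f ω ≤ -(δ / 2)}) fun ω => ?_
    · rw [P.expect_smul (indicator_mem_boundedFun _) hε.le, expect_indicator,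
        hf0 _ (half_pos hδ0), mul_zero] at h1
      linarith
    · have h2 := (abs_le.1 (hC ω)).1
      have h3 := le_abs_self C
      simp only [Pi.smul_apply, smul_eq_mul, Set.indicator_apply, Set.mem_ofPred_eq, Pi.one_apply]
      split_ifs <;> linarith

theorem marketPower_expect_le (P : FinAddProb Ω) : marketPower P.expect ≤ 0 := by
  refine sSup_le ?_
  rintro _ ⟨N, f, hf, rfl⟩
  rw [marketPowerOn, P.expect_sum _ fun i _ => (hf i).1, sub_self, extQuot]
  split_ifs <;> simp_all

/-! ### Countable additivity -/

theorem IsCountablyAdditive.tendsto_prob {P : FinAddProb Ω} (hP : P.IsCountablyAdditive)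
    {B : ℕ → Set Ω} (hB : Monotone B) (hU : ⋃ n, B n = Set.univ) :
    Tendsto (fun n => P.prob (B n)) atTop (𝓝 1) := by
  have h1 := (hP _ (disjoint_disjointed B)).tendsto_sum_nat
  rw [iUnion_disjointed, hU, P.univ] at h1
  have h2 : ∀ n, ∑ i ∈ Finset.range (n + 1), P.prob (disjointed B i) = P.prob (B n) := by
    intro n
    induction n with
    | zero => simp
    | succ n ih =>
      rw [Finset.sum_range_succ, ih, hB.disjointed_add_one, ← P.add _ _ Set.disjoint_sdiff_right,
        Set.union_sdiff_cancel (hB (Nat.le_add_right n 1))]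
  exact (h1.comp (tendsto_add_atTop_nat 1)).congr h2

/-- Monotone convergence: the events where the partial sum is within `ε / 2` of the limit increase
to `Ω`, so their complements have vanishing probability, and boundedness of the sum controls the
loss there. -/
theorem IsCountablyAdditive.tendsto_expect {P : FinAddProb Ω} (hP : P.IsCountablyAdditive)
    {f : ℕ → Ω → ℝ} (hf : f ∈ boundedSumSeq Ω) :
    Tendsto (fun k => ∑ n ∈ Finset.range k, P.expect (f n)) atTop
      (𝓝 (P.expect fun ω => ∑' n, f n ω)) := by
  classical
  obtain ⟨hf1, hf2, C, hC⟩ := hf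
  set F : Ω → ℝ := fun ω => ∑' n, f n ω with hF
  have hS : ∀ k, ∑ n ∈ Finset.range k, f n ∈ boundedFun Ω := fun k =>
    sum_mem_boundedFun _ fun n _ => (hf1 n).1
  have hS0 : ∀ k ω, 0 ≤ (∑ n ∈ Finset.range k, f n) ω := fun k ω => by
    rw [Finset.sum_apply]
    exact Finset.sum_nonneg fun n _ => (hf1 n).2 ω
  have hSF : ∀ k ω, (∑ n ∈ Finset.range k, f n) ω ≤ F ω := fun k ω => by
    rw [Finset.sum_apply]
    exact (hf2 ω).sum_le_tsum _ fun n _ => (hf1 n).2 ω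
  have hSm : ∀ ω, Monotone fun k => (∑ n ∈ Finset.range k, f n) ω := fun ω k l hkl => by
    simp only [Finset.sum_apply]
    exact Finset.sum_le_sum_of_subset_of_nonneg (Finset.range_mono hkl) fun n _ _ => (hf1 n).2 ω
  simp only [← P.expect_sum _ fun n _ => (hf1 n).1]
  rw [Metric.tendsto_atTop]
  intro ε hε
  set B : ℕ → Set Ω := fun k => {ω | F ω ≤ (∑ n ∈ Finset.range k, f n) ω + ε / 2} with hBdef
  have hB : Monotone B := fun k l hkl ω hω =>
    le_trans (b := (∑ n ∈ Finset.range k, f n) ω + ε / 2) hω (add_le_add_left (hSm ω hkl) _)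
  have hU : ⋃ k, B k = Set.univ := by
    refine Set.eq_univ_of_forall fun ω => ?_
    have h1 := (hf2 ω).hasSum.tendsto_sum_nat
    have h2 : F ω - ε / 2 < F ω := by linarith
    obtain ⟨k, hk⟩ := (h1.eventually (lt_mem_nhds h2)).exists
    refine Set.mem_iUnion.2 ⟨k, ?_⟩
    change F ω ≤ (∑ n ∈ Finset.range k, f n) ω + ε / 2
    rw [Finset.sum_apply]
    linarith
  -- This threshold keeps the loss on the exceptional set below `ε / 2`; the `+ 1` covers `C = 0`.
  have hη : 1 - ε / (2 * (|C| + 1)) < 1 := by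
    have : 0 < ε / (2 * (|C| + 1)) := by positivity
    linarith
  obtain ⟨N, hN⟩ := eventually_atTop.1 ((hP.tendsto_prob hB hU).eventually (lt_mem_nhds hη))
  refine ⟨N, fun k hk => ?_⟩
  have h1 := P.expect_mono (hS k) ⟨C, hC⟩ (hSF k)
  have h2 := P.expect_le_of_le_add ⟨C, hC⟩ (hS k) (abs_nonneg C) (ε := ε / 2) (A := (B k)ᶜ)
    fun ω => by
      by_cases hω : ω ∈ B k
      · have : F ω ≤ _ := hω
        simpa [hω] using this
      · have h3 := (abs_le.1 (hC ω)).2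
        have h4 := hS0 k ω
        rw [Set.indicator_of_mem (Set.mem_compl hω), Pi.one_apply, mul_one]
        linarith [le_abs_self C]
  have h3 : P.prob (B k)ᶜ < ε / (2 * (|C| + 1)) := by
    linarith [hN k hk, P.prob_add_compl (B k)]
  have h4 : |C| * P.prob (B k)ᶜ < ε / 2 := by
    calc |C| * P.prob (B k)ᶜ ≤ (|C| + 1) * P.prob (B k)ᶜ := by
          gcongr
          · exact P.nonneg _
          · linarith
      _ < (|C| + 1) * (ε / (2 * (|C| + 1))) := by gcongr
      _ = ε / 2 := by field_simp
  rw [Real.dist_eq, abs_lt]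
  constructor <;> linarith

/-- The partial sums converge to the price `R` of the sum. If `R > 0` they eventually exceed `R /
2`, so the quotients are at least `-1`; if `R = 0` each quotient is `0` or `1`. This crude bound is
enough for finiteness. -/
theorem IsCountablyAdditive.negCountablePower_expect_lt_top {P : FinAddProb Ω}
    (hP : P.IsCountablyAdditive) (hge : IsCommonOrder ge) (hPr : P.Represents ge) :
    negCountablePower P.expect < ⊤ := by
  have hle : ((-1 : ℝ) : EReal) ≤
      sInf {x | ∃ f ∈ boundedSumSeq Ω, x = countablePowerOn P.expect f} := by
    refine le_sInf ?_
    rintro _ ⟨f, hf, rfl⟩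
    refine ge_of_tendsto (tendsto_countablePowerOn hge hPr.isPriceFunction_expect hf) ?_
    have h1 := hP.tendsto_expect hf
    have h2 : ∀ n, 0 ≤ P.expect (f n) := fun n => by
      have := P.expect_mono ⟨0, fun _ => by simp⟩ (hf.1 n).1 (hf.1 n).2
      rwa [show P.expect (0 : Ω → ℝ) = 0 from P.expect_const 0] at this
    have hS : ∀ k, 0 ≤ ∑ n ∈ Finset.range k, P.expect (f n) := fun k =>
      Finset.sum_nonneg fun n _ => h2 n
    have hR : 0 ≤ P.expect fun ω => ∑' n, f n ω := ge_of_tendsto' h1 hS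
    simp only [countableQuot]
    set R := P.expect fun ω => ∑' n, f n ω with hRdef
    rcases hR.eq_or_lt with hR | hR
    · refine Eventually.of_forall fun k => ?_
      rw [← hR, sub_zero, extQuot]
      have := hS k
      split_ifs with h3
      · exact_mod_cast (by norm_num : (-1 : ℝ) ≤ 0)
      · rw [div_self h3, EReal.coe_le_coe_iff]
        norm_num
    · filter_upwards [h1.eventually (lt_mem_nhds (half_lt_self hR))] with k hk
      have h3 : 0 < ∑ n ∈ Finset.range k, P.expect (f n) := (half_pos hR).trans hk
      rw [extQuot, if_neg h3.ne', EReal.coe_le_coe_iff, le_div_iff₀ h3]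
      linarith
  rw [negCountablePower, lt_top_iff_ne_top, Ne, EReal.neg_eq_top_iff]
  intro h
  rw [h] at hle
  exact absurd hle (not_le.2 (EReal.bot_lt_coe _))

theorem prob_iUnion_eq_sum_add (P : FinAddProb Ω) {A : ℕ → Set Ω}
    (hA : Pairwise fun i j => Disjoint (A i) (A j)) (k : ℕ) :
    P.prob (⋃ n, A n) = ∑ n ∈ Finset.range k, P.prob (A n) + P.prob (⋃ n, A (n + k)) := by
  induction k with
  | zero => simp
  | succ k ih =>
    have h1 : ⋃ n, A (n + k) = A k ∪ ⋃ n, A (n + (k + 1)) := by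
      ext ω
      simp only [Set.mem_iUnion, Set.mem_union]
      constructor
      · rintro ⟨_ | n, hn⟩
        · exact Or.inl (by simpa using hn)
        · exact Or.inr ⟨n, by rwa [Nat.add_right_comm] at hn⟩
      · rintro (h | ⟨n, hn⟩)
        · exact ⟨0, by simpa using h⟩
        · exact ⟨n + 1, by rwa [Nat.add_right_comm]⟩
    have h2 : Disjoint (A k) (⋃ n, A (n + (k + 1))) :=
      Set.disjoint_iUnion_right.2 fun n => hA (by omega)
    rw [ih, h1, P.add _ _ h2, Finset.sum_range_succ, add_assoc]

/-- A finitely additive probability that is countably subadditive up to a constant is countably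
additive. -/
theorem isCountablyAdditive_of_le (P : FinAddProb Ω) {C : ℝ} (hC : 0 ≤ C)
    (h : ∀ A : ℕ → Set Ω, Pairwise (fun i j => Disjoint (A i) (A j)) →
      ∃ k, P.prob (⋃ n, A n) ≤ C * ∑ n ∈ Finset.range k, P.prob (A n)) :
    P.IsCountablyAdditive := by
  intro A hA
  have hs : Summable fun n => P.prob (A n) :=
    summable_of_sum_range_le (c := 1) (fun n => P.nonneg _) fun k => by
      linarith [P.prob_iUnion_eq_sum_add hA k, P.prob_le_one (⋃ n, A n),
        P.nonneg (⋃ n, A (n + k))]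
  have h0 : Tendsto (fun k => C * ∑' n, P.prob (A (n + k))) atTop (𝓝 0) := by
    simpa using (tendsto_sum_nat_add fun n => P.prob (A n)).const_mul C
  have h1 : Tendsto (fun k => P.prob (⋃ n, A (n + k))) atTop (𝓝 0) := by
    refine squeeze_zero (fun k => P.nonneg _) (fun k => ?_) h0
    -- The hypothesis on the tail sequence bounds the mass of the tail union by `C` times a tail of
    -- a convergent series.
    obtain ⟨m, hm⟩ := h (fun n => A (n + k)) fun i j hij => hA (by omega)
    refine hm.trans (mul_le_mul_of_nonneg_left ?_ hC)
    exact ((summable_nat_add_iff k).2 hs).sum_le_tsum _ fun n _ => P.nonneg _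
  rw [hasSum_iff_tendsto_nat_of_nonneg fun n => P.nonneg _]
  have h2 := (tendsto_const_nhds (x := P.prob (⋃ n, A n))).sub h1
  rw [sub_zero] at h2
  refine h2.congr fun k => ?_
  linarith [P.prob_iUnion_eq_sum_add hA k]

end FinAddProb

/-! ### From a subadditive set function to an additive one -/

/-- A subadditive set function whose sums over finite partitions are controlled by a constant is
dominated by an additive one with the same null sets. -/
theorem exists_additive_majorant {Ω : Type*} {ρ : Set Ω → ℝ}
    (hsub : ∀ A B, Disjoint A B → ρ (A ∪ B) ≤ ρ A + ρ B) {K : ℝ}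
    (hK : ∀ (A : Set Ω) (N : ℕ) (c : Ω → Fin N), ∑ i, ρ (A ∩ c ⁻¹' {i}) ≤ K * ρ A) :
    ∃ σ : Set Ω → ℝ, (∀ A B, Disjoint A B → σ (A ∪ B) = σ A + σ B) ∧
      (∀ A, ρ A ≤ σ A) ∧ ∀ A, σ A ≤ K * ρ A := by
  classical
  -- A finite partition is encoded as a colouring of all of `Ω`, so the same one restricts to `A`,
  -- `B` and `A ∪ B`.
  set S : Set Ω → Set ℝ := fun A =>
    {x | ∃ (N : ℕ) (c : Ω → Fin N), x = ∑ i, ρ (A ∩ c ⁻¹' {i})} with hS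
  have hself : ∀ A, ρ A ∈ S A := fun A => ⟨1, fun _ => 0, by simp⟩
  have hbdd : ∀ A, BddAbove (S A) := fun A =>
    ⟨K * ρ A, by rintro _ ⟨N, c, rfl⟩; exact hK A N c⟩
  refine ⟨fun A => sSup (S A), fun A B hAB => le_antisymm ?_ ?_,
    fun A => le_csSup (hbdd A) (hself A), fun A => csSup_le ⟨_, hself A⟩ ?_⟩
  · refine csSup_le ⟨_, hself _⟩ ?_
    rintro _ ⟨N, c, rfl⟩
    calc ∑ i, ρ ((A ∪ B) ∩ c ⁻¹' {i})
        ≤ ∑ i, (ρ (A ∩ c ⁻¹' {i}) + ρ (B ∩ c ⁻¹' {i})) := by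
          refine Finset.sum_le_sum fun i _ => ?_
          rw [Set.union_inter_distrib_right]
          exact hsub _ _ (hAB.mono Set.inter_subset_left Set.inter_subset_left)
      _ = ∑ i, ρ (A ∩ c ⁻¹' {i}) + ∑ i, ρ (B ∩ c ⁻¹' {i}) := Finset.sum_add_distrib
      _ ≤ sSup (S A) + sSup (S B) :=
          add_le_add (le_csSup (hbdd A) ⟨N, c, rfl⟩) (le_csSup (hbdd B) ⟨N, c, rfl⟩)
  · rw [← le_sub_iff_add_le]
    refine csSup_le ⟨_, hself A⟩ ?_
    rintro _ ⟨N, c, rfl⟩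
    rw [le_sub_comm]
    refine csSup_le ⟨_, hself B⟩ ?_
    rintro _ ⟨M, d, rfl⟩
    rw [le_sub_iff_add_le']
    -- For superadditivity, glue colourings of `A` and `B` with disjoint palettes: each block then
    -- lies in only one of the two sets.
    refine le_csSup (hbdd _)
      ⟨N + M, fun ω => if ω ∈ A then Fin.castAdd M (c ω) else Fin.natAdd N (d ω), ?_⟩
    rw [Fin.sum_univ_add]
    have hne : ∀ i j, Fin.castAdd M i ≠ Fin.natAdd N j := fun i j hij => by
      have := congrArg Fin.val hij
      simp only [Fin.val_castAdd, Fin.val_natAdd] at this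
      omega
    congr 1
    · refine Finset.sum_congr rfl fun i _ => congrArg ρ ?_
      ext ω
      by_cases hω : ω ∈ A
      · simp [hω, Fin.ext_iff]
      · simp [hω, (hne _ _).symm]
    · refine Finset.sum_congr rfl fun i _ => congrArg ρ ?_
      ext ω
      by_cases hω : ω ∈ A
      · simp [hω, hne, Set.disjoint_left.1 hAB hω]
      · simp [hω, Fin.ext_iff]
  · rintro _ ⟨N, c, rfl⟩
    exact hK A N c

/-! ### Price functions with bounded market power -/

namespace IsPriceFunction

variable {Ω : Type*} {ge : (Ω → ℝ) → (Ω → ℝ) → Prop} {ρ : (Ω → ℝ) → ℝ}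

theorem map_zero (hρ : IsPriceFunction ge (boundedFun Ω) ρ) : ρ 0 = 0 := by
  have hz : (0 : Ω → ℝ) ∈ boundedFun Ω := ⟨0, fun ω => by simp⟩
  simpa using hρ.pos_homog 0 hz 0 le_rfl (by simpa using hz)

theorem nonneg (hge : IsCommonOrder ge) (hρ : IsPriceFunction ge (boundedFun Ω) ρ) {f : Ω → ℝ}
    (hf : f ∈ boundedFunNonneg Ω) : 0 ≤ ρ f := by
  rw [← hρ.map_zero]
  exact hρ.mono f hf.1 0 ⟨0, fun ω => by simp⟩ (hge.of_pointwise _ _ hf.2)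

/-- No arbitrage gives one direction and monotonicity the other. -/
theorem indicator_eq_zero_iff (hge : IsCommonOrder ge) (hρ : IsPriceFunction ge (boundedFun Ω) ρ)
    (A : Set Ω) : ρ (A.indicator 1) = 0 ↔ ge 0 (A.indicator 1) := by
  have hA := IsCommonOrder.indicator_mem A
  constructor
  · intro h
    by_contra hn
    exact (hρ.no_arbitrage _ hA.1 ⟨hge.of_pointwise _ _ hA.2, hn⟩).ne' h
  · intro h
    refine le_antisymm ?_ (hρ.nonneg hge hA)
    rw [← hρ.map_zero]
    exact hρ.mono 0 ⟨0, fun ω => by simp⟩ _ hA.1 h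

/-- Market power below one bounds sums of prices by the price of the sum. -/
theorem exists_sum_le (hge : IsCommonOrder ge) (hρ : IsPriceFunction ge (boundedFun Ω) ρ)
    (hm : marketPower ρ < 1) :
    ∃ K : ℝ, 0 < K ∧ ∀ (N : ℕ) (f : Fin N → Ω → ℝ), (∀ i, f i ∈ boundedFunNonneg Ω) →
      ∑ i, ρ (f i) ≤ K * ρ (∑ i, f i) := by
  obtain ⟨r, hr, hr1⟩ := EReal.lt_iff_exists_real_btwn.1 hm
  have hr1 : 0 < 1 - r := sub_pos.2 (by exact_mod_cast hr1)
  -- With `S` the sum of prices and `R` the price of the sum, `(S - R) / S ≤ r` rearranges to `(1 -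
  -- r) S ≤ R`.
  refine ⟨(1 - r)⁻¹, inv_pos.2 hr1, fun N f hf => ?_⟩
  have h0 : marketPowerOn ρ f ≤ marketPower ρ := le_sSup ⟨N, f, hf, rfl⟩
  have h1 : marketPowerOn ρ f ≤ r := h0.trans hr.le
  have hS : 0 ≤ ∑ i, ρ (f i) := Finset.sum_nonneg fun i _ => hρ.nonneg hge (hf i)
  have hR : 0 ≤ ρ (∑ i, f i) := hρ.nonneg hge
    ⟨FinAddProb.sum_mem_boundedFun _ fun i _ => (hf i).1, Finset.sum_nonneg fun i _ => (hf i).2⟩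
  rcases hS.eq_or_lt with hS | hS
  · rw [← hS]
    exact mul_nonneg (inv_pos.2 hr1).le hR
  · rw [marketPowerOn, extQuot, if_neg hS.ne', EReal.coe_le_coe_iff, div_le_iff₀ hS] at h1
    rw [inv_mul_eq_div, le_div_iff₀ hr1]
    linarith

/-- A finite lower bound of countable market power bounds prices of sums by finite sums. -/
theorem exists_le_sum (hge : IsCommonOrder ge) (hρ : IsPriceFunction ge (boundedFun Ω) ρ)
    (hn : negCountablePower ρ < ⊤) :
    ∃ M : ℝ, 0 ≤ M ∧ ∀ f ∈ boundedSumSeq Ω, ∃ k,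
      ρ (fun ω => ∑' n, f n ω) ≤ M * ∑ n ∈ Finset.range k, ρ (f n) := by
  have hb : ⊥ < sInf {x | ∃ f ∈ boundedSumSeq Ω, x = countablePowerOn ρ f} := by
    rw [bot_lt_iff_ne_bot]
    intro h
    rw [negCountablePower, h, EReal.neg_bot] at hn
    exact lt_irrefl _ hn
  obtain ⟨c, -, hc⟩ := EReal.lt_iff_exists_real_btwn.1 hb
  -- A quotient `(S - R) / S` above `c` gives `R ≤ (1 - c) S ≤ (1 + |c|) S`.
  refine ⟨1 + |c|, by positivity, fun f hf => ?_⟩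
  have h1 : (c : EReal) < countablePowerOn ρ f := hc.trans_le (sInf_le ⟨f, hf, rfl⟩)
  obtain ⟨k, hk⟩ := ((tendsto_countablePowerOn hge hρ hf).eventually (lt_mem_nhds h1)).exists
  refine ⟨k, ?_⟩
  have hS : 0 ≤ ∑ n ∈ Finset.range k, ρ (f n) :=
    Finset.sum_nonneg fun n _ => hρ.nonneg hge (hf.1 n)
  rw [countableQuot] at hk
  rcases hS.eq_or_lt with hS | hS
  · rw [← hS, mul_zero]
    -- When `S = 0`, the convention `a / 0 = -∞` for `a < 0` rules out `R > 0`.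
    by_contra! hR
    rw [← hS, extQuot, if_pos rfl, if_neg (by linarith), if_pos (by linarith)] at hk
    exact not_lt_bot hk
  · rw [extQuot, if_neg hS.ne', EReal.coe_lt_coe_iff, lt_div_iff₀ hS] at hk
    have := mul_le_mul_of_nonneg_right (neg_abs_le c) hS.le
    linarith

/-- A price function of market power below one is equivalent, on events, to a finitely additive
probability. -/
theorem exists_finAddProb (hge : IsCommonOrder ge) (hρ : IsPriceFunction ge (boundedFun Ω) ρ)
    (hm : marketPower ρ < 1) :
    ∃ (P : FinAddProb Ω) (a b : ℝ), 0 < a ∧ 0 < b ∧ ∀ A : Set Ω,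
      a * ρ (A.indicator 1) ≤ P.prob A ∧ P.prob A ≤ b * ρ (A.indicator 1) := by
  classical
  obtain ⟨K, hK0, hK⟩ := hρ.exists_sum_le hge hm
  have hpos : ∀ A : Set Ω, 0 ≤ ρ (A.indicator 1) := fun A =>
    hρ.nonneg hge (IsCommonOrder.indicator_mem A)
  obtain ⟨σ, hadd, hle, hge'⟩ := exists_additive_majorant (ρ := fun A => ρ (A.indicator 1))
    (fun A B hAB => by
      have h1 : (A ∪ B).indicator (1 : Ω → ℝ) = A.indicator 1 + B.indicator 1 :=
        Set.indicator_union_of_disjoint hAB 1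
      have h2 := FinAddProb.indicator_mem_boundedFun (A ∪ B)
      rw [h1] at h2 ⊢
      exact hρ.subadd _ (FinAddProb.indicator_mem_boundedFun A) _
        (FinAddProb.indicator_mem_boundedFun B) h2)
    (K := K) (fun A N c => by
      have h1 : ∑ i, (A ∩ c ⁻¹' {i}).indicator (1 : Ω → ℝ) = A.indicator 1 := by
        ext ω
        by_cases hω : ω ∈ A <;> simp [Set.indicator_apply, hω]
      have h2 := hK N (fun i => (A ∩ c ⁻¹' {i}).indicator 1) fun i =>
        IsCommonOrder.indicator_mem _
      rwa [h1] at h2)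
  have hσ0 : 0 < σ Set.univ := by
    have h1 := hle Set.univ
    simp only [Set.indicator_univ, hρ.map_one] at h1
    linarith
  let P : FinAddProb Ω :=
    { prob := fun A => σ A / σ Set.univ
      nonneg := fun A => div_nonneg ((hpos A).trans (hle A)) hσ0.le
      univ := div_self hσ0.ne'
      add := fun A B hAB => by rw [hadd A B hAB, add_div] }
  refine ⟨P, (σ Set.univ)⁻¹, K / σ Set.univ, inv_pos.2 hσ0, div_pos hK0 hσ0, fun A => ⟨?_, ?_⟩⟩
  · rw [inv_mul_eq_div]
    exact div_le_div_of_nonneg_right (hle A) hσ0.le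
  · rw [div_mul_eq_mul_div]
    exact div_le_div_of_nonneg_right (hge' A) hσ0.le

end IsPriceFunction

/-! ### Transfer from prices to probabilities, and the theorem -/

theorem FinAddProb.represents_of_equiv {Ω : Type*} {ge : (Ω → ℝ) → (Ω → ℝ) → Prop}
    (hge : IsCommonOrder ge) (hr : IsRobustOrder ge) {ρ : (Ω → ℝ) → ℝ}
    (hρ : IsPriceFunction ge (boundedFun Ω) ρ) {P : FinAddProb Ω} {a b : ℝ} (ha : 0 < a)
    (h : ∀ A : Set Ω,
      a * ρ (A.indicator 1) ≤ P.prob A ∧ P.prob A ≤ b * ρ (A.indicator 1)) :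
    P.Represents ge := by
  refine (P.represents_iff hge).2 ⟨hr, fun A => ?_⟩
  rw [← hρ.indicator_eq_zero_iff hge]
  obtain ⟨h1, h2⟩ := h A
  constructor
  · intro hA
    rw [hA] at h1
    exact le_antisymm (nonpos_of_mul_nonpos_right h1 ha)
      (hρ.nonneg hge (IsCommonOrder.indicator_mem A))
  · intro hA
    rw [hA, mul_zero] at h2
    exact le_antisymm h2 (P.nonneg A)

theorem FinAddProb.isCountablyAdditive_of_equiv {Ω : Type*} {ge : (Ω → ℝ) → (Ω → ℝ) → Prop}
    (hge : IsCommonOrder ge) {ρ : (Ω → ℝ) → ℝ} (hρ : IsPriceFunction ge (boundedFun Ω) ρ)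
    (hn : negCountablePower ρ < ⊤) {P : FinAddProb Ω} {a b : ℝ} (ha : 0 < a) (hb : 0 < b)
    (h : ∀ A : Set Ω,
      a * ρ (A.indicator 1) ≤ P.prob A ∧ P.prob A ≤ b * ρ (A.indicator 1)) :
    P.IsCountablyAdditive := by
  classical
  obtain ⟨M, hM0, hM⟩ := hρ.exists_le_sum hge hn
  -- The constant comes from passing from `P` to `ρ` (factor `b`), using the countable bound for `ρ`
  -- (factor `M`), and returning to `P` (factor `1 / a`).
  refine P.isCountablyAdditive_of_le (C := b * M / a) (by positivity) fun A hA => ?_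
  have hsum : ∀ ω, HasSum (fun n => (A n).indicator (1 : Ω → ℝ) ω)
      ((⋃ n, A n).indicator (1 : Ω → ℝ) ω) := by
    intro ω
    by_cases hω : ∃ n, ω ∈ A n
    · obtain ⟨n, hn⟩ := hω
      have h1 : (⋃ n, A n).indicator (1 : Ω → ℝ) ω = (A n).indicator 1 ω := by
        rw [Set.indicator_of_mem hn, Set.indicator_of_mem (Set.mem_iUnion.2 ⟨n, hn⟩)]
      rw [h1]
      exact hasSum_single n fun m hm =>
        Set.indicator_of_notMem (fun hm' => Set.disjoint_left.1 (hA hm) hm' hn) _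
    · have h1 : ω ∉ ⋃ n, A n := fun h2 => hω (Set.mem_iUnion.1 h2)
      push Not at hω
      simp [h1, hω]
  have htsum : (fun ω => ∑' n, (A n).indicator (1 : Ω → ℝ) ω) = (⋃ n, A n).indicator 1 :=
    funext fun ω => (hsum ω).tsum_eq
  obtain ⟨k, hk⟩ := hM (fun n => (A n).indicator 1)
    ⟨fun n => IsCommonOrder.indicator_mem _, fun ω => (hsum ω).summable,
      htsum ▸ FinAddProb.indicator_mem_boundedFun _⟩
  rw [htsum] at hk
  refine ⟨k, (h _).2.trans ?_⟩
  have h1 : ∑ n ∈ Finset.range k, ρ ((A n).indicator 1) ≤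
      (∑ n ∈ Finset.range k, P.prob (A n)) / a := by
    rw [le_div_iff₀' ha, Finset.mul_sum]
    exact Finset.sum_le_sum fun n _ => (h (A n)).1
  calc b * ρ ((⋃ n, A n).indicator 1)
      ≤ b * (M * ∑ n ∈ Finset.range k, ρ ((A n).indicator 1)) := by gcongr
    _ ≤ b * (M * ((∑ n ∈ Finset.range k, P.prob (A n)) / a)) := by gcongr
    _ = b * M / a * ∑ n ∈ Finset.range k, P.prob (A n) := by ring

theorem mainTheorem7 {Ω : Type*} (ge : (Ω → ℝ) → (Ω → ℝ) → Prop) (hge : IsCommonOrder ge) :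
    ((∃ P : FinAddProb Ω, P.Represents ge) ↔
      (IsRobustOrder ge ∧
        ∃ ρ : (Ω → ℝ) → ℝ, IsPriceFunction ge (boundedFun Ω) ρ ∧ marketPower ρ < 1)) ∧
    ((∃ P : FinAddProb Ω, P.IsCountablyAdditive ∧ P.Represents ge) ↔
      (IsRobustOrder ge ∧
        ∃ ρ : (Ω → ℝ) → ℝ, IsPriceFunction ge (boundedFun Ω) ρ ∧ marketPower ρ < 1 ∧
          negCountablePower ρ < ⊤)) := by
  refine ⟨⟨?_, ?_⟩, ?_, ?_⟩
  · rintro ⟨P, hP⟩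
    exact ⟨((P.represents_iff hge).1 hP).1, P.expect, hP.isPriceFunction_expect,
      P.marketPower_expect_le.trans_lt zero_lt_one⟩
  · rintro ⟨hr, ρ, hρ, hm⟩
    obtain ⟨P, a, b, ha, -, h⟩ := hρ.exists_finAddProb hge hm
    exact ⟨P, FinAddProb.represents_of_equiv hge hr hρ ha h⟩
  · rintro ⟨P, hc, hP⟩
    exact ⟨((P.represents_iff hge).1 hP).1, P.expect, hP.isPriceFunction_expect,
      P.marketPower_expect_le.trans_lt zero_lt_one, hc.negCountablePower_expect_lt_top hge hP⟩
  · rintro ⟨hr, ρ, hρ, hm, hn⟩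
    obtain ⟨P, a, b, ha, hb, h⟩ := hρ.exists_finAddProb hge hm
    exact ⟨P, FinAddProb.isCountablyAdditive_of_equiv hge hρ hn ha hb h,
      FinAddProb.represents_of_equiv hge hr hρ ha h⟩
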